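/- Let $G_{\mathrm{phys}}=(V,E,F_{\mathrm{int}})$ be a planar patch: a finite cell complex in the plane $\mathbb R^2$ whose underlying space is homeomorphic to a closed disk, whose edges are piecewise $C^1$ arcs, and whose faces are open disks attached along closed edge walks (loops and parallel edges are allowed). Let $G=(V,E,F)$ with $F=F_{\mathrm{int}}\cup\{f_\infty\}$ be the extended complex obtained by adding the exterior region $f_\infty$, bounded by the boundary walk of the patch, as one more face. Let $B\in\mathbb F_2^{E\times F}$ be the edge--face incidence matrix of $G$. Let $\mathcal I$ be a set of labels and, for each $\alpha\in\mathcal I$, let $c_\alpha\in\mathbb F_2^E$ be the indicator chain of a simple path of $G$ (pairwise distinct vertices, at least one edge) with endpoints $u_\alpha,v_\alpha$. The endpoint graph $\Gamma_{\mathrm{end}}$ is the multigraph whose vertices are all the endpoints $u_\alpha,v_\alpha$ and which has, for each $\alpha\in\mathcal I$, one abstract edge $\eta_\alpha$ between $u_\alpha$ and $v_\alpha$. A multigraph is a forest if it contains no cycle, where two parallel edges form a cycle of length 2. A simple closed dual loop is a smooth regular simple closed curve $\gamma$ that avoids all vertices and crosses the edges transversally at finitely many interior points; it is represented by the cochain $w\in\mathbb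 F_2^E$ whose entry $w_e$ is the parity of the number of crossings of $\gamma$ with the edge $e$. A simple odd witness is the cochain $w$ of a simple closed dual loop such that $B^{\top}w=0$ and $$\langle w,c_\alpha\rangle=\sum_{e\in E}w_e\,(c_\alpha)_e=1\in\mathbb F_2\qquad\text{for all }\alpha\in\mathcal I .$$ Then: (i) If the endpoint graph $\Gamma_{\mathrm{end}}$ is a forest, then a simple odd witness exists. (ii) If the chains $c_\alpha$ are pairwise edge-disjoint and the union graph $\Gamma_{\mathrm{sig}}=\bigcup_{\alpha\in\mathcal I}c_\alpha$ (a subgraph of the graph $(V,E)$) has no cycle, then a simple odd witness exists. -/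

import Mathlib

open Set
open scoped ContDiff

noncomputable section

/-- The Euclidean plane. -/
abbrev Plane : Type := EuclideanSpace ℝ (Fin 2)

/-- The point of the unit circle at the angle `2πt`. -/
def circlePoint (t : ℝ) : Plane :=
  !₂[Real.cos (2 * Real.pi * t), Real.sin (2 * Real.pi * t)]

/-- A planar patch: a finite cell complex in the plane, with vertices `V`, edges `E` and
plaquettes `F`, whose underlying space is a closed disk.  Loops and parallel edges are allowed.
Edges are arcs that are continuously differentiable away from finitely many parameters
(straight, polygonal or curved), so that transversality to an edge makes sense. -/
structure PlanarPatch (V E F : Type*) where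
  /-- position of a vertex -/
  pos : V → Plane
  /-- first end of an edge -/
  src : E → V
  /-- second end of an edge -/
  tgt : E → V
  /-- parametrization of an edge, relevant on `[0,1]` only -/
  arc : E → ℝ → Plane
  /-- characteristic map of a plaquette, relevant on the closed unit disk only -/
  char : F → Plane → Plane
  /-- number of steps of the closed edge walk around a plaquette -/
  bdLen : F → ℕ
  /-- the closed edge walk around a plaquette: edges with a direction (`true`: from `src`) -/
  bd : (f : F) → Fin (bdLen f) → E × Bool
  /-- identification of the closed unit disk with the underlying space of the patch -/
  disk : Plane → Plane
  /-- number of steps of the closed edge walk along the boundary of the patch -/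
  outerLen : ℕ
  /-- the closed edge walk along the boundary of the patch -/
  outer : Fin outerLen → E × Bool
  -- vertices and edges
  pos_injective : Function.Injective pos
  arc_continuousOn : ∀ e, ContinuousOn (arc e) (Icc 0 1)
  arc_zero : ∀ e, arc e 0 = pos (src e)
  arc_one : ∀ e, arc e 1 = pos (tgt e)
  arc_injOn : ∀ e, InjOn (arc e) (Ioo 0 1)
  arc_ne_pos : ∀ e, ∀ t ∈ Ioo (0 : ℝ) 1, ∀ v, arc e t ≠ pos v
  arc_disjoint : ∀ e e', e ≠ e' → Disjoint (arc e '' Ioo 0 1) (arc e' '' Ioo 0 1)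
  arc_piecewise : ∀ e, ∃ S : Set ℝ, S.Finite ∧
    ∀ t ∈ Ioo (0 : ℝ) 1, t ∉ S → ContDiffAt ℝ 1 (arc e) t
  -- plaquettes: open disks, attached along closed edge walks
  bdLen_pos : ∀ f, 0 < bdLen f
  char_continuousOn : ∀ f, ContinuousOn (char f) (Metric.closedBall 0 1)
  char_injOn : ∀ f, InjOn (char f) (Metric.ball 0 1)
  char_bd : ∀ f, ∀ j : Fin (bdLen f), ∀ t ∈ Icc (0 : ℝ) 1,
    char f (circlePoint (((j : ℕ) + t) / bdLen f)) =
      arc (bd f j).1 (if (bd f j).2 then t else 1 - t)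
  char_ne_pos : ∀ f, ∀ x ∈ Metric.ball (0 : Plane) 1, ∀ v, char f x ≠ pos v
  char_disjoint_arc : ∀ f e, Disjoint (char f '' Metric.ball 0 1) (arc e '' Ioo 0 1)
  char_disjoint : ∀ f f', f ≠ f' →
    Disjoint (char f '' Metric.ball 0 1) (char f' '' Metric.ball 0 1)
  -- the union of all cells is a closed disk, whose boundary circle is a closed edge walk
  outerLen_pos : 0 < outerLen
  disk_continuousOn : ContinuousOn disk (Metric.closedBall 0 1)
  disk_injOn : InjOn disk (Metric.closedBall 0 1)
  disk_image : disk '' Metric.closedBall 0 1 =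
    range pos ∪ (⋃ e, arc e '' Ioo 0 1) ∪ ⋃ f, char f '' Metric.ball 0 1
  disk_outer : ∀ j : Fin outerLen, ∀ t ∈ Icc (0 : ℝ) 1,
    disk (circlePoint (((j : ℕ) + t) / outerLen)) =
      arc (outer j).1 (if (outer j).2 then t else 1 - t)

/-- A cycle in a multigraph: `m ≥ 1` distinct vertices and `m` distinct edges in cyclic order
(a loop for `m = 1`, two parallel edges for `m = 2`). A forest is a multigraph without cycles. -/
def IsForestMultigraph {α β : Type*} (G : Graph α β) : Prop :=
  ¬ ∃ m : ℕ, 0 < m ∧ ∃ (x : ZMod m → α) (e : ZMod m → β),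
    Function.Injective x ∧ Function.Injective e ∧ ∀ i, G.IsLink (e i) (x i) (x (i + 1))

/-- The endpoint graph of a family of chains with endpoints `u a`, `v a`: one abstract edge `a`
between `u a` and `v a` for every label `a`. -/
def endpointGraph {V I : Type*} (u v : I → V) : Graph V I where
  vertexSet := {x | ∃ a, x = u a ∨ x = v a}
  IsLink a x y := (x = u a ∧ y = v a) ∨ (x = v a ∧ y = u a)
  isLink_symm := by
    intro a _
    exact ⟨fun x y h => by tauto⟩
  eq_or_eq_of_isLink_of_isLink := by
    intro a x y z w h h'
    grind
  left_mem_of_isLink := by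
    rintro a x y (⟨rfl, rfl⟩ | ⟨rfl, rfl⟩)
    · exact ⟨a, Or.inl rfl⟩
    · exact ⟨a, Or.inr rfl⟩

namespace PlanarPatch

variable {V E F I : Type*}

/-- The edge `e` has the ends `x` and `y`. -/
def Joins (P : PlanarPatch V E F) (e : E) (x y : V) : Prop :=
  (P.src e = x ∧ P.tgt e = y) ∨ (P.src e = y ∧ P.tgt e = x)

open Classical in
/-- The incidence matrix `B` between edges and faces of the extended complex, with `none` for the
outer face: how often, mod 2, the closed walk around a face uses an edge. -/
def incidence (P : PlanarPatch V E F) : Matrix E (Option F) (ZMod 2) :=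
  fun e f => match f with
    | some f => ∑ j, if (P.bd f j).1 = e then 1 else 0
    | none => ∑ j, if (P.outer j).1 = e then 1 else 0

open Classical in
/-- The 1-chain `c` is a simple primal path from `u` to `v` (with at least one edge): the sum of
the edges of a walk through pairwise distinct vertices. -/
def IsSimplePath (P : PlanarPatch V E F) (c : E → ZMod 2) (u v : V) : Prop :=
  ∃ n : ℕ, 0 < n ∧ ∃ (x : Fin (n + 1) → V) (e : Fin n → E),
    Function.Injective x ∧ x 0 = u ∧ x (Fin.last n) = v ∧
    (∀ i : Fin n, P.Joins (e i) (x i.castSucc) (x i.succ)) ∧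
    c = ∑ i, Pi.single (e i) 1

/-- The union of the chains, as a subgraph of the 1-skeleton. -/
def signalGraph (P : PlanarPatch V E F) (c : I → E → ZMod 2) : Graph V E where
  vertexSet := {x | ∃ a e, c a e ≠ 0 ∧ (x = P.src e ∨ x = P.tgt e)}
  IsLink e x y := (∃ a, c a e ≠ 0) ∧ P.Joins e x y
  isLink_symm := by
    intro e _
    exact ⟨fun x y h => ⟨h.1, h.2.symm⟩⟩
  eq_or_eq_of_isLink_of_isLink := by
    intro e x y z w h h'
    simp only [Joins] at h h'
    grind
  left_mem_of_isLink := by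
    rintro e x y ⟨⟨a, ha⟩, (⟨rfl, rfl⟩ | ⟨rfl, rfl⟩)⟩
    · exact ⟨a, e, ha, Or.inl rfl⟩
    · exact ⟨a, e, ha, Or.inr rfl⟩

/-- A simple closed dual loop: a smooth regular simple closed curve (of period 1) in dual
position, that is, it avoids the vertices and crosses the edges transversally, at finitely many
points (where the edges are differentiable). -/
structure IsSimpleClosedDualLoop (P : PlanarPatch V E F) (γ : ℝ → Plane) : Prop where
  contDiff : ContDiff ℝ ∞ γ
  deriv_ne_zero : ∀ s, deriv γ s ≠ 0
  periodic : Function.Periodic γ 1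
  injOn : InjOn γ (Ico 0 1)
  ne_pos : ∀ s v, γ s ≠ P.pos v
  transverse : ∀ e, ∀ s, ∀ t ∈ Ioo (0 : ℝ) 1, γ s = P.arc e t →
    ContDiffAt ℝ 1 (P.arc e) t ∧ LinearIndependent ℝ ![deriv γ s, deriv (P.arc e) t]
  finite_crossings : ∀ e, {s ∈ Ico (0 : ℝ) 1 | γ s ∈ P.arc e '' Ioo 0 1}.Finite

/-- The 1-cochain of a closed curve: the parity of its number of crossings with each edge. -/
def crossingCochain (P : PlanarPatch V E F) (γ : ℝ → Plane) : E → ZMod 2 :=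
  fun e => ({s ∈ Ico (0 : ℝ) 1 | γ s ∈ P.arc e '' Ioo 0 1}.ncard : ZMod 2)

/-- `w` is a simple odd witness for the chains `c`: it is the 1-cochain of a simple closed dual
loop, hence a 1-cocycle of the extended complex, and it pairs to 1 with every chain. -/
def IsSimpleOddWitness [Fintype E] (P : PlanarPatch V E F) (c : I → E → ZMod 2)
    (w : E → ZMod 2) : Prop :=
  (∃ γ, P.IsSimpleClosedDualLoop γ ∧ w = P.crossingCochain γ) ∧
  P.incidence.transpose.mulVec w = 0 ∧
  ∀ a, ∑ e, w e * c a e = 1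

end PlanarPatch

end

/-! Every coboundary `δs` of a 0-cochain `s : V → ZMod 2` is the crossing cochain of a simple closed
dual loop (`exists_crossingCochain_eq`). A diffeomorphism of the plane pulls the vertices with `s =
1` into the unit disk and pushes the others out to radius at least 2. The preimage of a circle
between the two separates the classes, and for almost every radius it is transverse to the edges. An
edge then crosses it with the parity of the number of side changes between its ends.

A coboundary vanishes on closed edge walks, hence is a cocycle for every face, and it pairs with a
path from `u` to `v` to `s u + s v`. So only a suitable `s` is needed, and on a forest every
1-cochain mod 2 is a coboundary (`IsForestMultigraph.exists_coboundary`). For (i), the constant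
cochain 1 on the endpoint graph is integrated; for (ii), the indicator on the signal graph of one
chosen edge per chain. -/

/-! ### Cochains mod 2 on forests -/

theorem IsForestMultigraph.not_isLink_self {α β : Type*} {G : Graph α β}
    (hG : IsForestMultigraph G) (e : β) (x : α) : ¬ G.IsLink e x x := fun h =>
  hG ⟨1, one_pos, fun _ => x, fun _ => e, fun _ _ _ => Subsingleton.elim _ _,
    fun _ _ _ => Subsingleton.elim _ _, fun _ => h⟩

theorem IsForestMultigraph.eq_of_isLink {α β : Type*} {G : Graph α β}
    (hG : IsForestMultigraph G) {e f : β} {x y : α} (he : G.IsLink e x y)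
    (hf : G.IsLink f x y) : e = f := by
  by_contra hne
  have hxy : x ≠ y := by
    rintro rfl
    exact hG.not_isLink_self e x he
  refine hG ⟨2, two_pos, ![x, y], ![e, f], ?_, ?_, ?_⟩
  · intro i j h
    fin_cases i <;> fin_cases j <;> simp_all
    all_goals exact rfl
  · intro i j h
    fin_cases i <;> fin_cases j <;> simp_all
    all_goals exact rfl
  · intro i
    fin_cases i
    · exact he
    · exact hf.symm

/-- The simple graph underlying a multigraph without loops. -/
def Graph.toSimple {α β : Type*} (G : Graph α β) (h : ∀ e x, ¬ G.IsLink e x x) :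
    SimpleGraph α where
  Adj x y := ∃ e, G.IsLink e x y
  symm := ⟨fun _ _ ⟨e, he⟩ => ⟨e, he.symm⟩⟩
  loopless := ⟨fun x ⟨e, he⟩ => h e x he⟩

/-- A simple-graph cycle lifts to a multigraph cycle indexed by `ZMod p.length`. A repeated edge
would have to be traversed in opposite directions, forcing `2 = 0`, impossible for length at least
3. -/
theorem IsForestMultigraph.isAcyclic {α β : Type*} {G : Graph α β}
    (hG : IsForestMultigraph G) : (G.toSimple hG.not_isLink_self).IsAcyclic := by
  intro v p hp
  have h3 := hp.three_le_length
  have hpos : 0 < p.length := by omega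
  have : NeZero p.length := ⟨hpos.ne'⟩
  have hlt : ∀ i : ZMod p.length, i.val < p.length := fun i => ZMod.val_lt i
  set x : ZMod p.length → α := fun i => p.getVert i.val with hx
  have hinj : Function.Injective x := by
    intro i j h
    exact ZMod.val_injective _ (hp.getVert_injOn' (by have := hlt i; simp; omega)
      (by have := hlt j; simp; omega) h)
  have hnext : ∀ i, x (i + 1) = p.getVert (i.val + 1) := by
    intro i
    have : Fact (1 < p.length) := ⟨by omega⟩
    rcases (Nat.succ_le_of_lt (hlt i)).lt_or_eq with h | h
    · simp only [hx]
      rw [ZMod.val_add_of_lt, ZMod.val_one]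
      rw [ZMod.val_one]
      exact h
    · have h0 : i + 1 = 0 := by
        rw [← ZMod.natCast_zmod_val i]
        have : ((i.val + 1 : ℕ) : ZMod p.length) = 0 := by
          rw [show i.val + 1 = p.length from h]
          simp
        exact_mod_cast this
      simp only [hx]
      rw [h0, show i.val + 1 = p.length from h]
      simp
  have hadj : ∀ i, ∃ e, G.IsLink e (x i) (x (i + 1)) := by
    intro i
    rw [hnext]
    exact p.adj_getVert_succ (hlt i)
  choose e he using hadj
  refine hG ⟨p.length, hpos, x, e, hinj, ?_, he⟩
  intro i j hij
  have h1 := G.eq_or_eq_of_isLink_of_isLink (he i) (hij ▸ he j)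
  have h2 := G.eq_or_eq_of_isLink_of_isLink (he i).symm (hij ▸ he j)
  rcases h1 with h1 | h1
  · exact hinj h1
  rcases h2 with h2 | h2
  · have h1 := hinj h1
    have h2 := hinj h2
    have h0 : ((2 : ℕ) : ZMod p.length) = 0 := by
      push_cast
      linear_combination h2 - h1
    rw [ZMod.natCast_eq_zero_iff] at h0
    have := Nat.le_of_dvd two_pos h0
    omega
  · exact add_right_cancel (hinj h2)

open Classical in
/-- In a forest, the indicator of one edge is a coboundary mod 2. -/
theorem IsForestMultigraph.exists_coboundary_single {α β : Type*} {G : Graph α β}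
    (hG : IsForestMultigraph G) (e : β) :
    ∃ b : α → ZMod 2, ∀ f z w, G.IsLink f z w → b z + b w = if f = e then 1 else 0 := by
  by_cases hee : ∃ x y, G.IsLink e x y
  swap
  · refine ⟨0, fun f z w h => ?_⟩
    rw [if_neg]
    · simp
    · rintro rfl
      exact hee ⟨z, w, h⟩
  obtain ⟨x, y, hxy⟩ := hee
  set H := G.toSimple hG.not_isLink_self with hH
  have hb : H.IsBridge s(x, y) :=
    SimpleGraph.isAcyclic_iff_forall_adj_isBridge.1 hG.isAcyclic ⟨e, hxy⟩
  rw [SimpleGraph.isBridge_iff] at hb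
  set K := H.deleteEdges {s(x, y)} with hK
  -- The edge is a bridge: its removal puts its ends in different components, and the indicator of
  -- one component changes along this edge only.
  refine ⟨fun z => if K.Reachable x z then 1 else 0, fun f z w h => ?_⟩
  by_cases hfe : f = e
  · subst hfe
    have h1 := G.eq_or_eq_of_isLink_of_isLink h hxy
    have h2 := G.eq_or_eq_of_isLink_of_isLink h.symm hxy
    rw [if_pos rfl]
    rcases h1 with rfl | rfl
    · rcases h2 with rfl | rfl
      · exact absurd h (hG.not_isLink_self _ _)
      · simp [hb]
    · rcases h2 with rfl | rfl
      · simp [hb]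
      · exact absurd h (hG.not_isLink_self _ _)
  · have hadj : K.Adj z w := by
      rw [hK, SimpleGraph.deleteEdges_adj]
      refine ⟨⟨f, h⟩, ?_⟩
      rw [Set.mem_singleton_iff, Sym2.eq_iff]
      rintro (⟨rfl, rfl⟩ | ⟨rfl, rfl⟩)
      · exact hfe (hG.eq_of_isLink h hxy)
      · exact hfe (hG.eq_of_isLink h hxy.symm)
    have hiff : K.Reachable x z ↔ K.Reachable x w :=
      ⟨fun h => h.trans hadj.reachable, fun h => h.trans hadj.symm.reachable⟩
    simp only [hiff, if_neg hfe]
    exact CharTwo.add_self_eq_zero _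

/-- In a forest, every 1-cochain mod 2 is a coboundary. -/
theorem IsForestMultigraph.exists_coboundary {α β : Type*} [Finite α] {G : Graph α β}
    (hG : IsForestMultigraph G) (τ : β → ZMod 2) :
    ∃ s : α → ZMod 2, ∀ e x y, G.IsLink e x y → s x + s y = τ e := by
  classical
  -- The edge type may be infinite, but without parallel edges a finite vertex type leaves finitely
  -- many actual edges to sum over.
  have hfin : {e | ∃ x y, G.IsLink e x y}.Finite := by
    rw [← Set.finite_coe_iff]
    choose x y h using fun e : {e | ∃ x y, G.IsLink e x y} => e.2
    refine Finite.of_injective (fun e => (x e, y e)) fun e f hef => ?_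
    have h1 : x e = x f := congrArg Prod.fst hef
    have h2 : y e = y f := congrArg Prod.snd hef
    exact Subtype.ext (hG.eq_of_isLink (h e) (h1 ▸ h2 ▸ h f))
  choose b hb using hG.exists_coboundary_single
  refine ⟨fun z => ∑ e ∈ hfin.toFinset, τ e * b e z, fun f z w h => ?_⟩
  rw [← Finset.sum_add_distrib]
  simp_rw [← mul_add, hb _ f z w h]
  simp only [mul_ite, mul_one, mul_zero]
  rw [Finset.sum_ite_eq, if_pos]
  simpa using ⟨z, w, h⟩

/-! ### Simple zeros and regular values on the line -/

/-- A function on `[0,1]` changes sign as often as it has zeros, if all zeros are simple. -/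
theorem mul_neg_one_pow_card_zeros_pos (Z : Finset ℝ) : ∀ g : ℝ → ℝ,
    ContinuousOn g (Icc 0 1) → (∀ t ∈ Icc (0 : ℝ) 1, g t = 0 ↔ t ∈ Z) →
    (∀ t ∈ Z, t ∈ Ioo (0 : ℝ) 1) → (∀ t ∈ Z, DifferentiableAt ℝ g t ∧ deriv g t ≠ 0) →
    0 < g 0 * g 1 * (-1) ^ Z.card := by
  induction Z using Finset.induction_on with
  | empty =>
    intro g hg hz _ _
    simp only [Finset.card_empty, pow_zero, mul_one]
    by_contra! hle
    have h01 : (0 : ℝ) ∈ uIcc (g 0) (g 1) := by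
      rw [mem_uIcc]
      rcases le_total (g 0) 0 with h0 | h0 <;> rcases le_total (g 1) 0 with h1 | h1
      · rcases mul_eq_zero.1 (le_antisymm hle (mul_nonneg_of_nonpos_of_nonpos h0 h1)) with h | h
        · exact Or.inr ⟨h1, h.ge⟩
        · exact Or.inl ⟨h0, h.ge⟩
      · exact Or.inl ⟨h0, h1⟩
      · exact Or.inr ⟨h1, h0⟩
      · rcases mul_eq_zero.1 (le_antisymm hle (mul_nonneg h0 h1)) with h | h
        · exact Or.inl ⟨h.le, h1⟩
        · exact Or.inr ⟨h.le, h0⟩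
    rw [← uIcc_of_le (zero_le_one' ℝ)] at hg
    obtain ⟨t, ht, h0⟩ := intermediate_value_uIcc hg h01
    rw [uIcc_of_le (zero_le_one' ℝ)] at ht
    simpa using (hz t ht).1 h0
  | insert z Z hzZ ih =>
    intro g hg hz hsub hd
    have hz01 := hsub z (Finset.mem_insert_self z Z)
    obtain ⟨hdz, hdz0⟩ := hd z (Finset.mem_insert_self z Z)
    have hgz : g z = 0 := (hz z (Ioo_subset_Icc_self hz01)).2 (Finset.mem_insert_self z Z)
    -- Divide out the zero `z`: the quotient `dslope g z` has value `g'(z) ≠ 0` at `z` and keeps the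
    -- other simple zeros, while `t - z` contributes one sign change.
    have hfac : ∀ t, g t = (t - z) * dslope g z t := by
      intro t
      have := sub_smul_dslope g z t
      rw [hgz, sub_zero, smul_eq_mul] at this
      exact this.symm
    have hne : ∀ t ∈ Z, t ≠ z := fun t ht h => hzZ (h ▸ ht)
    have key := ih (dslope g z)
      ((continuousOn_dslope (Icc_mem_nhds hz01.1 hz01.2)).2 ⟨hg, hdz⟩) ?_
      (fun t ht => hsub t (Finset.mem_insert_of_mem ht)) ?_
    · rw [Finset.card_insert_of_notMem hzZ, pow_succ, hfac 0, hfac 1]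
      have : 0 < z * (1 - z) := mul_pos hz01.1 (sub_pos.2 hz01.2)
      have := mul_pos this key
      linarith
    · intro t ht
      rcases eq_or_ne t z with rfl | htz
      · simp [hdz0, hzZ]
      · have h1 := hz t ht
        rw [hfac t, mul_eq_zero, or_iff_right (sub_ne_zero.2 htz), Finset.mem_insert,
          or_iff_right htz] at h1
        exact h1
    · intro t ht
      obtain ⟨hdt, hdt0⟩ := hd t (Finset.mem_insert_of_mem ht)
      have hdd : DifferentiableAt ℝ (dslope g z) t :=
        (differentiableAt_dslope_of_ne (hne t ht)).2 hdt
      refine ⟨hdd, fun h0 => hdt0 ?_⟩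
      have hs0 : dslope g z t = 0 := by
        have hgt := (hz t (Ioo_subset_Icc_self (hsub t (Finset.mem_insert_of_mem ht)))).2
          (Finset.mem_insert_of_mem ht)
        rw [hfac t] at hgt
        exact (mul_eq_zero.1 hgt).resolve_left (sub_ne_zero.2 (hne t ht))
      have h1 := ((hasDerivAt_id t).sub_const z).mul hdd.hasDerivAt
      rw [hs0, h0] at h1
      have h2 := h1.congr_of_eventuallyEq (Filter.Eventually.of_forall hfac)
      simpa using h2.deriv

/-- A continuous function on `[0,1]` without zeros at the ends and with simple zeros only has
finitely many zeros. -/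
theorem finite_zeros_of_deriv_ne_zero {g : ℝ → ℝ} (hg : ContinuousOn g (Icc 0 1))
    (hd : ∀ t ∈ Icc (0 : ℝ) 1, g t = 0 → DifferentiableAt ℝ g t ∧ deriv g t ≠ 0) :
    {t ∈ Icc (0 : ℝ) 1 | g t = 0}.Finite := by
  by_contra hinf
  -- Infinitely many zeros would accumulate at a zero, but a zero with nonzero derivative is
  -- isolated.
  obtain ⟨t, ht, hacc⟩ := Set.Infinite.exists_accPt_of_subset_isCompact hinf isCompact_Icc
    (sep_subset _ _)
  have hcl : IsClosed {t ∈ Icc (0 : ℝ) 1 | g t = 0} :=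
    hg.preimage_isClosed_of_isClosed isClosed_Icc isClosed_singleton
  have hmem : t ∈ {t ∈ Icc (0 : ℝ) 1 | g t = 0} :=
    hcl.closure_eq ▸ mem_closure_iff_clusterPt.2 hacc.clusterPt
  obtain ⟨hdt, hdt0⟩ := hd t hmem.1 hmem.2
  have hev := hdt.hasDerivAt.eventually_ne hdt0 (c := 0)
  rw [accPt_iff_frequently_nhdsNE] at hacc
  obtain ⟨x, hx, hx0⟩ := (hacc.and_eventually hev).exists
  exact hx0 hx.2

/-- Sard's theorem on the line: almost all values are regular. -/
theorem exists_regular_value {E : Type*} [Finite E] (g : E → ℝ → ℝ) (S : E → Set ℝ)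
    (hS : ∀ e, (S e).Finite)
    (hd : ∀ e, ∀ t ∈ Ioo (0 : ℝ) 1, t ∉ S e → DifferentiableAt ℝ (g e) t) {a b : ℝ} (hab : a < b) :
    ∃ c ∈ Ioo a b, ∀ e, ∀ t ∈ Ioo (0 : ℝ) 1, g e t = c → t ∉ S e ∧ deriv (g e) t ≠ 0 := by
  have hnull : ∀ e, MeasureTheory.volume
      (g e '' S e ∪ g e '' {t ∈ Ioo (0 : ℝ) 1 | t ∉ S e ∧ deriv (g e) t = 0}) = 0 := by
    intro e
    refine MeasureTheory.measure_union_null (((hS e).image _).measure_zero _) ?_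
    refine MeasureTheory.addHaar_image_eq_zero_of_det_fderivWithin_eq_zero (f' := fun _ => 0)
      MeasureTheory.volume (fun t ht => ?_) (fun t _ => ?_)
    · have h := (hd e t ht.1 ht.2.1).hasDerivAt
      rw [ht.2.2] at h
      have h := h.hasFDerivAt.hasFDerivWithinAt (s := {t ∈ Ioo (0 : ℝ) 1 | t ∉ S e ∧ deriv (g e) t = 0})
      simpa using h
    · simp [ContinuousLinearMap.det]
  have hall := MeasureTheory.measure_iUnion_null hnull
  have hpos : MeasureTheory.volume (Ioo a b) ≠ 0 := by
    rw [Real.volume_Ioo]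
    simpa using hab
  obtain ⟨c, hc, hc'⟩ : ∃ c ∈ Ioo a b, c ∉ ⋃ e, (g e '' S e ∪
      g e '' {t ∈ Ioo (0 : ℝ) 1 | t ∉ S e ∧ deriv (g e) t = 0}) := by
    by_contra! h
    exact hpos (MeasureTheory.measure_mono_null h hall)
  refine ⟨c, hc, fun e t ht hgt => ?_⟩
  simp only [mem_iUnion, mem_union, not_exists, not_or] at hc'
  have hts : t ∉ S e := fun h => (hc' e).1 ⟨t, h, hgt⟩
  exact ⟨hts, fun h => (hc' e).2 ⟨t, ⟨ht, hts, h⟩, hgt⟩⟩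

/-! ### The parametrized unit circle -/

theorem circlePoint_apply_zero (t : ℝ) : circlePoint t 0 = Real.cos (2 * Real.pi * t) := rfl

theorem circlePoint_apply_one (t : ℝ) : circlePoint t 1 = Real.sin (2 * Real.pi * t) := rfl

theorem Plane.norm_sq (q : Plane) : ‖q‖ ^ 2 = q 0 ^ 2 + q 1 ^ 2 := by
  rw [EuclideanSpace.real_norm_sq_eq, Fin.sum_univ_two]

theorem norm_circlePoint (t : ℝ) : ‖circlePoint t‖ = 1 := by
  rw [← sq_eq_sq₀ (norm_nonneg _) zero_le_one, Plane.norm_sq, circlePoint_apply_zero,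
    circlePoint_apply_one, Real.cos_sq_add_sin_sq, one_pow]

theorem circlePoint_periodic : Function.Periodic circlePoint 1 := by
  intro t
  ext i
  fin_cases i
  · change Real.cos (2 * Real.pi * (t + 1)) = Real.cos (2 * Real.pi * t)
    rw [mul_add, mul_one, Real.cos_add_two_pi]
  · change Real.sin (2 * Real.pi * (t + 1)) = Real.sin (2 * Real.pi * t)
    rw [mul_add, mul_one, Real.sin_add_two_pi]

theorem contDiff_circlePoint : ContDiff ℝ ∞ circlePoint := by
  rw [contDiff_euclidean]
  intro i
  fin_cases i
  · change ContDiff ℝ ∞ fun t => Real.cos (2 * Real.pi * t)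
    fun_prop
  · change ContDiff ℝ ∞ fun t => Real.sin (2 * Real.pi * t)
    fun_prop

theorem circlePoint_injOn : InjOn circlePoint (Ico 0 1) := by
  intro s hs t ht h
  have h0 : Real.cos (2 * Real.pi * s) = Real.cos (2 * Real.pi * t) := congrArg (fun q => q 0) h
  have h1 : Real.sin (2 * Real.pi * s) = Real.sin (2 * Real.pi * t) := congrArg (fun q => q 1) h
  obtain ⟨k, hk⟩ := Real.Angle.angle_eq_iff_two_pi_dvd_sub.1 (Real.Angle.cos_sin_inj h0 h1)
  rw [← mul_sub] at hk
  have hk := mul_left_cancel₀ Real.two_pi_pos.ne' hk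
  have hk1 : (k : ℝ) < 1 := by linarith [hs.2, ht.1]
  have hk2 : (-1 : ℝ) < k := by linarith [ht.2, hs.1]
  have : k = 0 := by
    have h1 : k < 1 := by exact_mod_cast hk1
    have h2 : -1 < k := by exact_mod_cast hk2
    omega
  rw [this, Int.cast_zero] at hk
  linarith

theorem exists_circlePoint_eq {q : Plane} (hq : ‖q‖ = 1) :
    ∃ t ∈ Ico (0 : ℝ) 1, circlePoint t = q := by
  have hz : ‖(⟨q 0, q 1⟩ : ℂ)‖ = 1 := by
    rw [← sq_eq_sq₀ (norm_nonneg _) zero_le_one, Complex.sq_norm, Complex.normSq_mk]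
    rw [← sq, ← sq, ← Plane.norm_sq, hq]
  have hne : (⟨q 0, q 1⟩ : ℂ) ≠ 0 := by
    rw [← norm_pos_iff, hz]
    exact one_pos
  set θ := Complex.arg ⟨q 0, q 1⟩
  have hθ : circlePoint (θ / (2 * Real.pi)) = q := by
    have hm : 2 * Real.pi * (θ / (2 * Real.pi)) = θ := mul_div_cancel₀ _ Real.two_pi_pos.ne'
    ext i
    fin_cases i
    · change Real.cos (2 * Real.pi * (θ / (2 * Real.pi))) = q 0
      rw [hm, Complex.cos_arg hne, hz, div_one]
    · change Real.sin (2 * Real.pi * (θ / (2 * Real.pi))) = q 1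
      rw [hm, Complex.sin_arg, hz, div_one]
  refine ⟨Int.fract (θ / (2 * Real.pi)), ⟨Int.fract_nonneg _, Int.fract_lt_one _⟩, ?_⟩
  rw [← hθ, ← Int.self_sub_floor]
  simpa only [mul_one] using circlePoint_periodic.sub_int_mul_eq ⌊θ / (2 * Real.pi)⌋

theorem deriv_circlePoint_ne_zero (t : ℝ) : deriv circlePoint t ≠ 0 := by
  intro h
  have hd : HasDerivAt circlePoint 0 t :=
    h ▸ (contDiff_circlePoint.differentiable (by simp) t).hasDerivAt
  have hc : ∀ i, HasDerivAt (fun s => circlePoint s i) 0 t := fun i => by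
    have hi := (EuclideanSpace.proj (𝕜 := ℝ) i).hasFDerivAt.comp_hasDerivAt t hd
    rwa [map_zero] at hi
  have hl : HasDerivAt (fun s : ℝ => 2 * Real.pi * s) (2 * Real.pi) t := by
    simpa using (hasDerivAt_id t).const_mul (2 * Real.pi)
  have h0 := (hc 0).unique hl.cos
  have h1 := (hc 1).unique hl.sin
  have hpi := Real.two_pi_pos.ne'
  have hs : Real.sin (2 * Real.pi * t) = 0 := by
    simpa [hpi] using h0.symm
  have hc : Real.cos (2 * Real.pi * t) = 0 := by
    simpa [hpi] using h1.symm
  simpa [hs, hc] using Real.sin_sq_add_cos_sq (2 * Real.pi * t)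

/-! ### Separating vertices by a diffeomorphism -/

/-- A linear form `x + a y` separates finitely many points of the plane. -/
theorem exists_separating_shear {V : Type*} [Finite V] {pos : V → Plane}
    (hpos : Function.Injective pos) :
    ∃ a : ℝ, Function.Injective fun v => pos v 0 + a * pos v 1 := by
  -- These are the only values of `a` that can identify two points.
  have hfin : (range fun vw : V × V =>
      -(pos vw.1 0 - pos vw.2 0) / (pos vw.1 1 - pos vw.2 1)).Finite := finite_range _
  obtain ⟨a, ha⟩ := hfin.exists_notMem
  refine ⟨a, fun v w h => hpos ?_⟩
  simp only at h
  by_cases h1 : pos v 1 = pos w 1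
  · rw [h1] at h
    ext i
    fin_cases i
    · exact add_right_cancel h
    · exact h1
  · refine absurd ⟨(v, w), ?_⟩ ha
    rw [div_eq_iff (sub_ne_zero.2 h1)]
    linarith

/-- For every subset of a finite set of points in the plane there is a global diffeomorphism
of the plane that maps this subset into the unit disk and the others outside the disk of
radius 2. -/
theorem exists_diffeo_separating {V : Type*} [Finite V] {pos : V → Plane}
    (hpos : Function.Injective pos) (T : Set V) :
    ∃ Ψ Φ : Plane → Plane, ContDiff ℝ ∞ Ψ ∧ ContDiff ℝ ∞ Φ ∧
      Function.LeftInverse Φ Ψ ∧ Function.RightInverse Φ Ψ ∧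
      (∀ v ∈ T, ‖Ψ (pos v)‖ ^ 2 < 1) ∧ ∀ v ∉ T, 4 ≤ ‖Ψ (pos v)‖ ^ 2 := by
  classical
  cases nonempty_fintype V
  obtain ⟨a, ha⟩ := exists_separating_shear hpos
  set X : V → ℝ := fun v => pos v 0 + a * pos v 1 with hX
  -- Adding `p(X)` to the second coordinate moves it to 0 on `T` and to 2 off `T`; dividing `X` by
  -- `R` brings the first coordinate into `(-1, 1)`.
  set p := Lagrange.interpolate Finset.univ X
    fun v => (if v ∈ T then 0 else 2) - pos v 1 with hp
  have hpe : ∀ v, p.eval (X v) = (if v ∈ T then 0 else 2) - pos v 1 := fun v =>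
    Lagrange.eval_interpolate_at_node _ ha.injOn (Finset.mem_univ v)
  set R : ℝ := 1 + ∑ v, |X v| with hR
  have hXR : ∀ v, |X v| < R := fun v => by
    have := Finset.single_le_sum (f := fun v => |X v|) (fun i _ => abs_nonneg _)
      (Finset.mem_univ v)
    linarith
  have hR0 : 0 < R := by positivity
  have hval : ∀ v, ‖(!₂[X v / R, pos v 1 + p.eval (X v)] : Plane)‖ ^ 2
      = (X v / R) ^ 2 + (if v ∈ T then 0 else 2) ^ 2 := fun v => by
    rw [Plane.norm_sq, hpe]
    simp
  have hpc : ContDiff ℝ ∞ fun x => p.eval x :=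
    p.contDiff_aeval (𝕜 := ℝ) ∞
  refine ⟨fun q => !₂[(q 0 + a * q 1) / R, q 1 + p.eval (q 0 + a * q 1)],
    fun q => !₂[R * q 0 - a * (q 1 - p.eval (R * q 0)), q 1 - p.eval (R * q 0)],
    ?_, ?_, ?_, ?_, ?_, ?_⟩
  · rw [contDiff_euclidean]
    intro i
    fin_cases i
    · change ContDiff ℝ ∞ fun q : Plane => (q 0 + a * q 1) / R
      fun_prop
    · change ContDiff ℝ ∞ fun q : Plane => q 1 + p.eval (q 0 + a * q 1)
      fun_prop
  · rw [contDiff_euclidean]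
    intro i
    fin_cases i
    · change ContDiff ℝ ∞ fun q : Plane => R * q 0 - a * (q 1 - p.eval (R * q 0))
      fun_prop
    · change ContDiff ℝ ∞ fun q : Plane => q 1 - p.eval (R * q 0)
      fun_prop
  · intro q
    ext i
    fin_cases i <;> simp [mul_div_cancel₀ _ hR0.ne']
  · intro q
    ext i
    fin_cases i <;> simp [hR0.ne']
  · intro v hv
    refine (hval v).trans_lt ?_
    rw [if_pos hv, zero_pow two_ne_zero, add_zero, sq_lt_one_iff_abs_lt_one, abs_div,
      abs_of_pos hR0, div_lt_one hR0]
    exact hXR v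
  · intro v hv
    refine le_trans ?_ (hval v).ge
    rw [if_neg hv]
    nlinarith [sq_nonneg (X v / R)]

/-! ### Coboundaries as crossing cochains -/

namespace PlanarPatch

variable {V E F I : Type*}

/-- Every 0-cochain has a simple closed dual loop whose crossing cochain is its coboundary. -/
theorem exists_crossingCochain_eq [Finite V] [Finite E] (P : PlanarPatch V E F)
    (s : V → ZMod 2) : ∃ γ, P.IsSimpleClosedDualLoop γ ∧
      ∀ e, P.crossingCochain γ e = s (P.src e) + s (P.tgt e) := by
  obtain ⟨Ψ, Φ, hΨ, hΦ, hl, hr, hin, hout⟩ :=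
    exists_diffeo_separating P.pos_injective {v | s v = 1}
  set f : Plane → ℝ := fun q => ‖Ψ q‖ ^ 2 with hf
  have hfd : Differentiable ℝ f := (hΨ.differentiable (by simp)).norm_sq ℝ
  choose S hS hSd using P.arc_piecewise
  -- `c` is the squared radius, strictly between the bounds 1 and 4 for the two classes of vertices
  -- and regular for `f` along every edge.
  obtain ⟨c, hc, hreg⟩ := exists_regular_value (fun e t => f (P.arc e t)) S hS
    (fun e t ht hts => (hfd _).comp t ((hSd e t ht hts).differentiableAt one_ne_zero))
    (show (1 : ℝ) < 4 by norm_num)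
  have hc0 : 0 < c := zero_lt_one.trans hc.1
  have hposc : ∀ v, f (P.pos v) ≠ c := by
    intro v
    by_cases hv : v ∈ {v | s v = 1}
    · exact ((hin v hv).trans hc.1).ne
    · exact (hc.2.trans_le (hout v hv)).ne'
  set r := √c with hrdef
  have hr0 : 0 < r := Real.sqrt_pos.2 hc0
  have hr2 : r ^ 2 = c := Real.sq_sqrt hc0.le
  set γ : ℝ → Plane := fun t => Φ (r • circlePoint t) with hγ
  have hΨγ : ∀ t, Ψ (γ t) = r • circlePoint t := fun t => hr _
  have hfγ : ∀ t, f (γ t) = c := by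
    intro t
    simp only [hf]
    rw [hΨγ, norm_smul, norm_circlePoint, mul_one, Real.norm_eq_abs, sq_abs, hr2]
  have hγs : ContDiff ℝ ∞ γ := hΦ.comp (contDiff_circlePoint.const_smul r)
  have hγd : ∀ t, HasDerivAt γ (deriv γ t) t := fun t =>
    (hγs.differentiable (by simp) t).hasDerivAt
  have hγ0 : ∀ t, deriv γ t ≠ 0 := by
    intro t h0
    have h1 := (hΨ.differentiable (by simp) (γ t)).hasFDerivAt.comp_hasDerivAt t (hγd t)
    rw [h0, map_zero] at h1
    have h2 : HasDerivAt (fun u => r • circlePoint u) (r • deriv circlePoint t) t :=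
      ((contDiff_circlePoint.differentiable (by simp) t).hasDerivAt).const_smul r
    have h3 : Ψ ∘ γ = fun u => r • circlePoint u := funext hΨγ
    rw [h3] at h1
    exact smul_ne_zero hr0.ne' (deriv_circlePoint_ne_zero t) (h2.unique h1)
  have hinj : InjOn γ (Ico 0 1) := by
    intro a ha b hb hab
    refine circlePoint_injOn ha hb (smul_right_injective Plane hr0.ne' ?_)
    simpa only [hΨγ] using congrArg Ψ hab
  -- The loop is the entire level set, so its crossings with an edge are exactly the zeros of `f -
  -- c` along that edge.
  have himg : γ '' Ico 0 1 = {q | f q = c} := by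
    ext q
    constructor
    · rintro ⟨t, _, rfl⟩
      exact hfγ t
    · intro hq
      have hn : ‖Ψ q‖ = r := by
        rw [hrdef, ← show ‖Ψ q‖ ^ 2 = c from hq, Real.sqrt_sq (norm_nonneg _)]
      obtain ⟨t, ht, htq⟩ := exists_circlePoint_eq (q := r⁻¹ • Ψ q) (by
        rw [norm_smul, hn, Real.norm_of_nonneg (inv_nonneg.2 hr0.le), inv_mul_cancel₀ hr0.ne'])
      refine ⟨t, ht, hl.injective ?_⟩
      rw [hΨγ, htq, smul_inv_smul₀ hr0.ne']
  -- the crossings with an edge, as parameters of the edge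
  set Z : E → Set ℝ := fun e => {t ∈ Icc (0 : ℝ) 1 | f (P.arc e t) - c = 0} with hZ
  have hends : ∀ e, ∀ t ∈ Icc (0 : ℝ) 1, f (P.arc e t) - c = 0 → t ∈ Ioo (0 : ℝ) 1 := by
    intro e t ht h
    have h := sub_eq_zero.1 h
    refine ⟨ht.1.lt_of_ne ?_, ht.2.lt_of_ne ?_⟩
    · rintro rfl
      exact hposc _ (P.arc_zero e ▸ h)
    · rintro rfl
      exact hposc _ (P.arc_one e ▸ h)
  have hcont : ∀ e, ContinuousOn (fun t => f (P.arc e t) - c) (Icc 0 1) := fun e =>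
    (hfd.continuous.comp_continuousOn (P.arc_continuousOn e)).sub continuousOn_const
  have hsimple : ∀ e, ∀ t ∈ Icc (0 : ℝ) 1, f (P.arc e t) - c = 0 →
      DifferentiableAt ℝ (fun t => f (P.arc e t) - c) t ∧
        deriv (fun t => f (P.arc e t) - c) t ≠ 0 := by
    intro e t ht h
    have ht' := hends e t ht h
    obtain ⟨hts, hd⟩ := hreg e t ht' (sub_eq_zero.1 h)
    rw [deriv_sub_const]
    exact ⟨((hfd _).comp t ((hSd e t ht' hts).differentiableAt one_ne_zero)).sub_const c, hd⟩
  have hZfin : ∀ e, (Z e).Finite := fun e =>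
    finite_zeros_of_deriv_ne_zero (hcont e) (hsimple e)
  have himgZ : ∀ e, γ '' {t ∈ Ico (0 : ℝ) 1 | γ t ∈ P.arc e '' Ioo 0 1} = P.arc e '' Z e := by
    intro e
    ext q
    constructor
    · rintro ⟨t, ⟨_, u, hu, hut⟩, rfl⟩
      refine ⟨u, ⟨Ioo_subset_Icc_self hu, ?_⟩, hut⟩
      rw [hut, hfγ, sub_self]
    · rintro ⟨u, ⟨hu, hu0⟩, rfl⟩
      have : P.arc e u ∈ γ '' Ico 0 1 := himg ▸ sub_eq_zero.1 hu0
      obtain ⟨t, ht, htu⟩ := this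
      exact ⟨t, ⟨ht, u, hends e u hu hu0, htu.symm⟩, htu⟩
  have hinjA : ∀ e, InjOn γ {t ∈ Ico (0 : ℝ) 1 | γ t ∈ P.arc e '' Ioo 0 1} := fun e =>
    hinj.mono (sep_subset _ _)
  refine ⟨γ, ⟨hγs, hγ0, fun t => ?_, hinj, fun t v h => hposc v (h ▸ hfγ t), ?_, fun e => ?_⟩,
    fun e => ?_⟩
  · simp only [hγ, circlePoint_periodic t]
  · intro e t u hu htu
    obtain ⟨hus, hd⟩ := hreg e u hu (htu ▸ hfγ t)
    have harc := hSd e u hu hus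
    refine ⟨harc, LinearIndependent.pair_iff.2 fun a b hab => ?_⟩
    -- The differential of `f` kills the tangent of the loop, which lies in a level set, but not
    -- that of the edge, since `c` is regular.
    have h1 := (hfd (γ t)).hasFDerivAt.comp_hasDerivAt t (hγd t)
    have h2 : f ∘ γ = fun _ => c := funext hfγ
    rw [h2] at h1
    have h3 := h1.unique (hasDerivAt_const t c)
    have h4 := ((hfd (P.arc e u)).hasFDerivAt.comp_hasDerivAt u
      (harc.differentiableAt one_ne_zero).hasDerivAt).deriv
    have h5 : fderiv ℝ f (P.arc e u) (deriv (P.arc e) u) ≠ 0 := h4 ▸ hd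
    have h6 := congrArg (fderiv ℝ f (γ t)) hab
    rw [map_add, map_smul, map_smul, map_zero, h3, smul_zero, zero_add, smul_eq_mul, htu] at h6
    have hb : b = 0 := (mul_eq_zero.1 h6).resolve_right h5
    rw [hb, zero_smul, add_zero] at hab
    exact ⟨(smul_eq_zero.1 hab).resolve_right (hγ0 t), hb⟩
  · refine Set.Finite.of_finite_image ?_ (hinjA e)
    rw [himgZ]
    exact (hZfin e).image _
  · have hcard : {t ∈ Ico (0 : ℝ) 1 | γ t ∈ P.arc e '' Ioo 0 1}.ncard
        = (hZfin e).toFinset.card := by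
      rw [← (hinjA e).ncard_image, himgZ, InjOn.ncard_image,
        ncard_eq_toFinset_card _ (hZfin e)]
      exact (P.arc_injOn e).mono fun t ht => hends e t ht.1 ht.2
    -- All zeros are simple, so their parity records whether `f - c` has opposite signs at the two
    -- ends of the edge.
    have hsign := mul_neg_one_pow_card_zeros_pos (hZfin e).toFinset
      (fun t => f (P.arc e t) - c) (hcont e) (fun t ht => by simp [hZ, ht.1, ht.2])
      (fun t ht => by
        rw [Set.Finite.mem_toFinset] at ht
        exact hends e t ht.1 ht.2)
      (fun t ht => by
        rw [Set.Finite.mem_toFinset] at ht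
        exact hsimple e t ht.1 ht.2)
    simp only [P.arc_zero, P.arc_one] at hsign
    rw [crossingCochain, hcard]
    have hneg : ∀ v, s v = 1 → f (P.pos v) - c < 0 := fun v hv =>
      sub_neg.2 ((hin v hv).trans hc.1)
    have hpos : ∀ v, s v = 0 → 0 < f (P.pos v) - c := fun v hv =>
      sub_pos.2 (hc.2.trans_le (hout v (by simp [hv])))
    have h01 : ∀ z : ZMod 2, z = 0 ∨ z = 1 := by decide
    rcases Nat.even_or_odd (hZfin e).toFinset.card with hev | hodd
    · rw [hev.neg_one_pow, mul_one] at hsign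
      rw [(ZMod.natCast_eq_zero_iff_even).2 hev]
      rcases h01 (s (P.src e)) with h | h <;> rcases h01 (s (P.tgt e)) with h' | h'
      · rw [h, h', add_zero]
      · exact absurd hsign (mul_neg_of_pos_of_neg (hpos _ h) (hneg _ h')).not_gt
      · exact absurd hsign (mul_neg_of_neg_of_pos (hneg _ h) (hpos _ h')).not_gt
      · rw [h, h']
        rfl
    · rw [hodd.neg_one_pow, mul_neg_one, neg_pos] at hsign
      rw [(ZMod.natCast_eq_one_iff_odd).2 hodd]
      rcases h01 (s (P.src e)) with h | h <;> rcases h01 (s (P.tgt e)) with h' | h'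
      · exact absurd hsign (mul_pos (hpos _ h) (hpos _ h')).not_gt
      · rw [h, h', zero_add]
      · rw [h, h', add_zero]
      · exact absurd hsign (mul_pos_of_neg_of_neg (hneg _ h) (hneg _ h')).not_gt

/-! ### Pairing coboundaries with walks and paths -/

open Classical in
/-- A coboundary vanishes on a closed edge walk. -/
theorem sum_coboundary_closed_walk [Fintype E] (P : PlanarPatch V E F) (s : V → ZMod 2) {n : ℕ}
    (hn : 0 < n) (w : Fin n → E × Bool) (φ : Plane → Plane)
    (hφ : ∀ j : Fin n, ∀ t ∈ Icc (0 : ℝ) 1, φ (circlePoint (((j : ℕ) + t) / n)) =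
      P.arc (w j).1 (if (w j).2 then t else 1 - t)) :
    ∑ e, (∑ j, if (w j).1 = e then (1 : ZMod 2) else 0) * (s (P.src e) + s (P.tgt e)) = 0 := by
  obtain ⟨m, rfl⟩ := Nat.exists_eq_add_of_le' hn
  set x : Fin (m + 1) → V := fun j => if (w j).2 then P.src (w j).1 else P.tgt (w j).1 with hx
  set y : Fin (m + 1) → V := fun j => if (w j).2 then P.tgt (w j).1 else P.src (w j).1 with hy
  have h0 : ∀ j : Fin (m + 1), φ (circlePoint ((j : ℕ) / (m + 1 : ℕ))) = P.pos (x j) := by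
    intro j
    have h := hφ j 0 (left_mem_Icc.2 zero_le_one)
    rw [add_zero] at h
    rw [h]
    cases hb : (w j).2 <;> simp [hx, hb, P.arc_zero, P.arc_one]
  have h1 : ∀ j : Fin (m + 1), φ (circlePoint (((j : ℕ) + 1) / (m + 1 : ℕ))) = P.pos (y j) := by
    intro j
    rw [hφ j 1 (right_mem_Icc.2 zero_le_one)]
    cases hb : (w j).2 <;> simp [hy, hb, P.arc_zero, P.arc_one]
  -- Consecutive steps fit together because `φ` has one value at their common circle point;
  -- periodicity of the circle closes the walk.
  have hxy : ∀ j, y j = x (j + 1) := by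
    intro j
    apply P.pos_injective
    rw [← h0, ← h1]
    rcases eq_or_ne j (Fin.last m) with rfl | hj
    · have hp := circlePoint_periodic 0
      have hm : ((m : ℝ) + 1) ≠ 0 := by positivity
      simp only [Fin.val_last, Fin.last_add_one, Fin.val_zero]
      push_cast
      rw [div_self hm, zero_div, ← hp, zero_add]
    · rw [Fin.val_add_one_of_lt (Fin.lt_last_iff_ne_last.2 hj)]
      push_cast
      rfl
  have hsum : ∀ j, s (P.src (w j).1) + s (P.tgt (w j).1) = s (x j) + s (x (j + 1)) := by
    intro j
    rw [← hxy]
    cases hb : (w j).2 <;> simp [hx, hy, hb, add_comm]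
  have hswap : ∑ e, (∑ j, if (w j).1 = e then (1 : ZMod 2) else 0) *
      (s (P.src e) + s (P.tgt e)) = ∑ j, (s (P.src (w j).1) + s (P.tgt (w j).1)) := by
    simp_rw [Finset.sum_mul]
    rw [Finset.sum_comm]
    simp
  have hshift : ∑ j, s (x (j + 1)) = ∑ j, s (x j) :=
    Equiv.sum_comp (Equiv.addRight (1 : Fin (m + 1))) fun j => s (x j)
  rw [hswap, Finset.sum_congr rfl fun j _ => hsum j, Finset.sum_add_distrib, hshift]
  exact CharTwo.add_self_eq_zero _

/-- The pairing of a coboundary with a simple path. -/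
theorem IsSimplePath.sum_coboundary [Fintype E] {P : PlanarPatch V E F} {c : E → ZMod 2} {u v : V}
    (hc : P.IsSimplePath c u v) (s : V → ZMod 2) :
    ∑ e, (s (P.src e) + s (P.tgt e)) * c e = s u + s v := by
  classical
  obtain ⟨n, -, x, e, -, rfl, rfl, hj, rfl⟩ := hc
  have hstep : ∀ i : Fin n, s (P.src (e i)) + s (P.tgt (e i)) = s (x i.castSucc) + s (x i.succ) := by
    intro i
    rcases hj i with ⟨h, h'⟩ | ⟨h, h'⟩
    · rw [h, h']
    · rw [h, h', add_comm]
  have hswap : ∑ e', (s (P.src e') + s (P.tgt e')) *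
      (∑ i, Pi.single (e i) 1 : E → ZMod 2) e' = ∑ i, (s (P.src (e i)) + s (P.tgt (e i))) := by
    simp_rw [Finset.sum_apply, Finset.mul_sum]
    rw [Finset.sum_comm]
    simp [Pi.single_apply]
  rw [hswap, Finset.sum_congr rfl fun i _ => hstep i, Finset.sum_add_distrib]
  -- Splitting off the first or the last vertex from the same sum yields the telescoping; what
  -- remains is a finite check in `ZMod 2`.
  have h1 := Fin.sum_univ_succ fun i => s (x i)
  rw [Fin.sum_univ_castSucc] at h1
  generalize ∑ i : Fin n, s (x i.castSucc) = A at *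
  generalize ∑ i : Fin n, s (x i.succ) = B at *
  generalize s (x 0) = p at *
  generalize s (x (Fin.last n)) = q at *
  revert A B p q
  decide

/-- The chain pairs to 1 with the coboundary of the indicator of `u`, since the ends of the path are
distinct. -/
theorem IsSimplePath.exists_ne_zero [Fintype E] {P : PlanarPatch V E F} {c : E → ZMod 2} {u v : V}
    (hc : P.IsSimplePath c u v) : ∃ e, c e ≠ 0 := by
  classical
  by_contra! h
  have hs := hc.sum_coboundary (Pi.single u 1)
  obtain ⟨n, hn, x, e, hx, rfl, rfl, -⟩ := hc
  have hne : x (Fin.last n) ≠ x 0 := fun h => by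
    have := congrArg Fin.val (hx h)
    simp at this
    omega
  simp [h, hne] at hs

/-- A coboundary that pairs to 1 with all chains is a simple odd witness. -/
theorem exists_isSimpleOddWitness [Finite V] [Fintype E] (P : PlanarPatch V E F)
    (c : I → E → ZMod 2) (s : V → ZMod 2)
    (hs : ∀ a, ∑ e, (s (P.src e) + s (P.tgt e)) * c a e = 1) :
    ∃ w, P.IsSimpleOddWitness c w := by
  obtain ⟨γ, hγ, hw⟩ := P.exists_crossingCochain_eq s
  refine ⟨P.crossingCochain γ, ⟨γ, hγ, rfl⟩, ?_, fun a => ?_⟩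
  · ext f
    simp only [Matrix.mulVec, dotProduct, Matrix.transpose_apply, hw, Pi.zero_apply]
    cases f with
    | none => exact P.sum_coboundary_closed_walk s P.outerLen_pos P.outer P.disk P.disk_outer
    | some f =>
      exact P.sum_coboundary_closed_walk s (P.bdLen_pos f) (P.bd f) (P.char f) (P.char_bd f)
  · simp only [hw]
    exact hs a

end PlanarPatch

/-! ### Choice of the 0-cochain in the two cases -/

theorem corollaryS2p3 {V E F I : Type*} [Fintype V] [Fintype E] [Fintype F]
    (P : PlanarPatch V E F) (c : I → E → ZMod 2) (u v : I → V)
    (hc : ∀ a, P.IsSimplePath (c a) (u a) (v a)) :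
    (IsForestMultigraph (endpointGraph u v) → ∃ w, P.IsSimpleOddWitness c w) ∧
    ((∀ a b, a ≠ b → ∀ e, c a e = 0 ∨ c b e = 0) →
      IsForestMultigraph (P.signalGraph c) → ∃ w, P.IsSimpleOddWitness c w) := by
  classical
  refine ⟨fun hforest => ?_, fun hdisj hforest => ?_⟩
  · obtain ⟨s, hs⟩ := hforest.exists_coboundary fun _ => 1
    refine P.exists_isSimpleOddWitness c s fun a => ?_
    rw [(hc a).sum_coboundary s]
    exact hs a (u a) (v a) (Or.inl ⟨rfl, rfl⟩)
  -- Mark one edge `g a` of each chain. By disjointness, `g a` is the only marked edge on the chain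
  -- of `a`, so the pairing is 1.
  · choose g hg using fun a => (hc a).exists_ne_zero
    obtain ⟨s, hs⟩ := hforest.exists_coboundary fun e => if e ∈ range g then 1 else 0
    refine P.exists_isSimpleOddWitness c s fun a => ?_
    have h01 : ∀ z : ZMod 2, z ≠ 0 → z = 1 := by decide
    rw [Finset.sum_eq_single (g a)]
    · rw [hs (g a) _ _ ⟨⟨a, hg a⟩, Or.inl ⟨rfl, rfl⟩⟩, if_pos (mem_range_self a), one_mul,
        h01 _ (hg a)]
    · intro e _ he
      by_cases hce : c a e = 0
      · rw [hce, mul_zero]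
      · rw [hs e _ _ ⟨⟨a, hce⟩, Or.inl ⟨rfl, rfl⟩⟩, if_neg, zero_mul]
        rintro ⟨b, rfl⟩
        have hab : a ≠ b := fun h => he (h ▸ rfl)
        exact (hdisj a b hab (g b)).elim hce (hg b)
    · simp
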